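/- Let $(G,\omega,\mu)$ be a connected, locally finite weighted graph: $G$ is a countably infinite vertex set, $\omega:G\times G\to[0,\infty)$ is symmetric, vanishes on the diagonal and satisfies $\sum_y\omega(x,y)<\infty$ for every $x$, and $\mu:G\to(0,\infty)$; write $x\sim y$ if $\omega(x,y)>0$. Let $\bar d$ be the combinatorial graph distance, fix a root $o\in G$, put $r(x)=\bar d(x,o)$ and $$\Delta f(x)=\frac1{\mu(x)}\sum_{y\in G}[f(y)-f(x)]\,\omega(x,y).$$ Suppose that $G$ is a spherically symmetric tree with root $o$ and constant branching function $b_0\in\mathbb N$, $b_0\ge 2$. This means that $\omega$ takes values in $\{0,1\}$, that $\omega(x,y)=0$ whenever $r(x)=r(y)$, that $\mu\equiv1$, and that for every $x$ with $r(x)\ge1$ $$\frac1{\mu(x)}\sum_{y:\,r(y)=r(x)+1}\omega(x,y)=b_0,\qquad \frac1{\mu(x)}\sum_{y:\,r(y)=r(x)-1}\omega(x,y)=1 .$$ Let $\rho:G\to(0,\infty)$ satisfy $\rho(x)\le c_0(1+r(x))^{-\alpha}$ for all $x\in G$, for some $c_0>0$ and $\alpha>1$. A solution of the Cauchy problem with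 initial datum $u_0:G\to\mathbb R$ is a function $u:G\times[0,\infty)\to\mathbb R$ such that $u(x,\cdot)\in C^1([0,\infty))$ for every $x\in G$, $$\rho(x)\,\partial_tu(x,t)-\Delta u(x,t)=0\quad\text{for all }x\in G,\ t>0,\qquad u(x,0)=u_0(x)\quad\text{for all }x\in G .$$ Let $\gamma\in\mathbb R$ and let $u_0:G\to\mathbb R$ satisfy $u_0\ge\gamma$ on $G$ and $u_0\equiv\gamma$ outside some ball $\{x:r(x)<R\}$. Then: 1. there is a bounded solution $u$ with initial datum $u_0$ such that, for every $t_0>0$, $u(x,t_0)\to\gamma$ as $r(x)\to+\infty$; 2. uniqueness fails: there are infinitely many bounded solutions with initial datum $u_0$. More precisely, there is a sequence $(u_i)_{i\in\mathbb N}$ of bounded solutions with initial datum $u_0$ such that, for $i\ne j$ and every $T>0$, $u_i$ and $u_j$ do not coincide on $G\times(0,T]$. -/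

import Mathlib

open Set Filter Topology

/-- A weighted graph on the vertex set `V`: a symmetric edge weight `ω ≥ 0` with zero diagonal and
finite row sums, together with a node measure `μ > 0`. -/
structure WeightedGraph (V : Type*) where
  /-- the edge weight -/
  ω : V → V → ℝ
  /-- the node measure -/
  μ : V → ℝ
  ω_nonneg : ∀ x y, 0 ≤ ω x y
  ω_symm : ∀ x y, ω x y = ω y x
  ω_self : ∀ x, ω x x = 0
  ω_summable : ∀ x, Summable (ω x)
  μ_pos : ∀ x, 0 < μ x

namespace WeightedGraph

variable {V : Type*} (G : WeightedGraph V)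

/-- The underlying combinatorial graph: `x ∼ y` if and only if `ω x y > 0`. -/
def toSimpleGraph : SimpleGraph V where
  Adj x y := 0 < G.ω x y
  symm := ⟨fun x y h => by rw [G.ω_symm y x]; exact h⟩
  loopless := ⟨fun x h => by rw [G.ω_self x] at h; exact lt_irrefl 0 h⟩

/-- Any two vertices are joined by a path. -/
def IsConnected : Prop := G.toSimpleGraph.Connected

/-- Every vertex has only finitely many neighbours. -/
def IsLocallyFinite : Prop := ∀ x, {y | 0 < G.ω x y}.Finite

/-- The combinatorial graph distance: least number of edges of a path from `x` to `y`. -/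
noncomputable def dist (x y : V) : ℕ := G.toSimpleGraph.dist x y

/-- The weighted Laplacian `Δ f (x) = μ(x)⁻¹ ∑_y (f y - f x) ω(x, y)`. -/
noncomputable def laplacian (f : V → ℝ) (x : V) : ℝ :=
  (1 / G.μ x) * ∑' y, (f y - f x) * G.ω x y

/-- The outer degree of `x` with respect to the root `o`: the normalized total weight of the edges
from `x` to the next sphere around `o`. -/
noncomputable def outerDegree (o x : V) : ℝ :=
  (1 / G.μ x) * ∑' y : {y : V // G.dist o y = G.dist o x + 1}, G.ω x y

/-- The inner degree of `x` with respect to the root `o`: the normalized total weight of the edges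
from `x` to the previous sphere around `o`. -/
noncomputable def innerDegree (o x : V) : ℝ :=
  (1 / G.μ x) * ∑' y : {y : V // G.dist o y + 1 = G.dist o x}, G.ω x y

/-- Spherically symmetric trees with root `o` and branching function `b`.
The conditions on the degrees are imposed on the spheres of radius `m ≥ 1` (the inner degree of the
root is `0`); the number of neighbours of the root is left free. The degree conditions contain the
spherical symmetry of the outer and inner degrees. -/
structure IsSphericallySymmetricTree (o : V) (b : ℕ → ℕ) : Prop where
  weight : ∀ x y, G.ω x y = 0 ∨ G.ω x y = 1
  sphere : ∀ x y, G.dist o x = G.dist o y → G.ω x y = 0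
  measure : ∀ x, G.μ x = 1
  outer : ∀ x, 1 ≤ G.dist o x → G.outerDegree o x = b (G.dist o x)
  inner : ∀ x, 1 ≤ G.dist o x → G.innerDegree o x = 1

/-- The parabolic operator `ℒ u = ρ ∂ₜ u - Δ u`, at the point `(x, t)`. -/
noncomputable def parabolic (ρ : V → ℝ) (u : V → ℝ → ℝ) (x : V) (t : ℝ) : ℝ :=
  ρ x * deriv (u x) t - G.laplacian (fun y => u y t) x

/-- Subsolutions of the Cauchy problem `ρ ∂ₜ u - Δ u = f` in `V × (0, ∞)`, `u = u₀` at time `0`.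
Only the values of `u` on `V × [0, ∞)` matter. -/
structure IsSubsolution (ρ : V → ℝ) (f : V → ℝ → ℝ) (u₀ : V → ℝ) (u : V → ℝ → ℝ) : Prop where
  contDiffOn : ∀ x, ContDiffOn ℝ 1 (u x) (Ici 0)
  le : ∀ x t, 0 < t → G.parabolic ρ u x t ≤ f x t
  initial : ∀ x, u x 0 ≤ u₀ x

/-- Supersolutions of the Cauchy problem `ρ ∂ₜ u - Δ u = f` in `V × (0, ∞)`, `u = u₀` at time `0`. -/
structure IsSupersolution (ρ : V → ℝ) (f : V → ℝ → ℝ) (u₀ : V → ℝ) (u : V → ℝ → ℝ) : Prop where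
  contDiffOn : ∀ x, ContDiffOn ℝ 1 (u x) (Ici 0)
  ge : ∀ x t, 0 < t → f x t ≤ G.parabolic ρ u x t
  initial : ∀ x, u₀ x ≤ u x 0

/-- Solutions of the Cauchy problem `ρ ∂ₜ u - Δ u = f` in `V × (0, ∞)`, `u = u₀` at time `0`. -/
def IsSolution (ρ : V → ℝ) (f : V → ℝ → ℝ) (u₀ : V → ℝ) (u : V → ℝ → ℝ) : Prop :=
  G.IsSubsolution ρ f u₀ u ∧ G.IsSupersolution ρ f u₀ u

/-- Boundedness of `u` on `V × [0, ∞)`. -/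
def IsBoundedSpaceTime (u : V → ℝ → ℝ) : Prop := ∃ M : ℝ, ∀ x t, 0 ≤ t → |u x t| ≤ M

end WeightedGraph

/-!
The proof works with the minimal nonnegative solution, and with a function `h ≥ 0` such that
`Δ h ≤ -ρ` and `h → 0` at infinity.

*Barrier.* On the tree, a radial function with decrements `a r = h r - h (r + 1)` satisfies
`Δ h = a (r - 1) - b₀ * a r` on the sphere of radius `r ≥ 1`. Since `b₀ ≥ 2` and the bound
`c r = c₀ (1 + r) ^ (-α)` for `ρ` is summable, the recursion `b₀ * a r = a (r - 1) + c r` has a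
summable solution, and `h r = ∑_{k ≥ r} a k` is as required
(`IsSphericallySymmetricTree.exists_radial_barrier`).

*Minimal solution.* For a bounded datum `f ≥ 0` the equation `ρ ∂ₜ v = Δ v` is solved by iterating
Duhamel's formula from `0` (Feller's construction). The operator preserves order, hence the iterates
increase and stay below every nonnegative supersolution. In particular, if `f ≤ M`, the
supersolution `M (1 - s / t + h / t)` on `0 ≤ s ≤ t` shows that `v x t ≤ M * h x / t`: the minimal
solution vanishes at infinity at every positive time (`exists_isSolution_le_barrier`).

*Conclusion.* With `v` the minimal solution for `u₀ - γ`, the function `u = γ + v` is the solution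
of the first part. With `p` the minimal solution for the datum `1`, the function `w = 1 - p` is a
bounded solution with datum `0` which tends to `1` at infinity at every positive time, so that the
functions `u + i w` are bounded solutions with datum `u₀`, pairwise different up to any time `T > 0`.
-/

/-! ### The Duhamel iteration -/

namespace JumpProcess

variable {V : Type*} (N : V → Finset V) (a : V → V → ℝ) (f : V → ℝ)

/-- The total rate of leaving `x`, for jump rates `a x y` to the finitely many sites `y ∈ N x`. -/
def exitRate (x : V) : ℝ := ∑ y ∈ N x, a x y

/-- The expected rate `∑_y a x y * p y t` of incoming mass. -/
def gain (p : V → ℝ → ℝ) (x : V) (t : ℝ) : ℝ := ∑ y ∈ N x, a x y * p y t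

/-- The Duhamel operator of `∂ₜ p = ∑_y a x y (p y - p x)`, `p x 0 = f x`, in which the loss term is
integrated exactly. Its fixed points are the solutions, and it preserves order. -/
noncomputable def duhamel (p : V → ℝ → ℝ) (x : V) (t : ℝ) : ℝ :=
  Real.exp (-(exitRate N a x * t)) *
    (f x + ∫ s in (0 : ℝ)..t, Real.exp (exitRate N a x * s) * gain N a p x s)

/-- The Duhamel iterates started from `0`. -/
noncomputable def approx (n : ℕ) : V → ℝ → ℝ := (duhamel N a f)^[n] 0

variable {N a f}

lemma approx_succ (n : ℕ) : approx N a f (n + 1) = duhamel N a f (approx N a f n) :=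
  Function.iterate_succ_apply' _ _ _

lemma continuous_gain {p : V → ℝ → ℝ} (hp : ∀ x, Continuous (p x)) (x : V) :
    Continuous (gain N a p x) := by
  unfold gain
  fun_prop

lemma continuous_exp_mul_gain {p : V → ℝ → ℝ} (hp : ∀ x, Continuous (p x)) (x : V) :
    Continuous fun s => Real.exp (exitRate N a x * s) * gain N a p x s := by
  have := continuous_gain (N := N) (a := a) hp x
  fun_prop

/-- The Duhamel operator turns continuous functions into solutions of the decoupled equations. -/
lemma hasDerivAt_duhamel {p : V → ℝ → ℝ} (hp : ∀ x, Continuous (p x)) (x : V) (t : ℝ) :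
    HasDerivAt (duhamel N a f p x)
      (gain N a p x t - exitRate N a x * duhamel N a f p x t) t := by
  have hc := continuous_exp_mul_gain (N := N) (a := a) hp x
  have h1 : HasDerivAt (fun t => f x + ∫ s in (0 : ℝ)..t,
      Real.exp (exitRate N a x * s) * gain N a p x s)
      (Real.exp (exitRate N a x * t) * gain N a p x t) t :=
    (intervalIntegral.integral_hasDerivAt_right (hc.intervalIntegrable _ _)
      hc.aestronglyMeasurable.stronglyMeasurableAtFilter hc.continuousAt).const_add _
  have h2 : HasDerivAt (fun t => Real.exp (-(exitRate N a x * t)))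
      (Real.exp (-(exitRate N a x * t)) * -(exitRate N a x)) t := by
    simpa using (((hasDerivAt_id t).const_mul (exitRate N a x)).neg).exp
  have h3 : HasDerivAt (duhamel N a f p x) _ t := h2.mul h1
  have he : Real.exp (-(exitRate N a x * t)) * Real.exp (exitRate N a x * t) = 1 := by
    rw [← Real.exp_add]; simp
  refine h3.congr_deriv ?_
  unfold duhamel
  linear_combination gain N a p x t * he

lemma continuous_duhamel {p : V → ℝ → ℝ} (hp : ∀ x, Continuous (p x)) (x : V) :
    Continuous (duhamel N a f p x) :=
  continuous_iff_continuousAt.2 fun t => (hasDerivAt_duhamel hp x t).continuousAt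

lemma duhamel_initial (p : V → ℝ → ℝ) (x : V) : duhamel N a f p x 0 = f x := by
  simp [duhamel]

lemma continuous_approx (n : ℕ) (x : V) : Continuous (approx N a f n x) := by
  induction n generalizing x with
  | zero => exact continuous_const
  | succ n ih => rw [approx_succ]; exact continuous_duhamel ih x

lemma gain_mono (ha : ∀ x y, 0 ≤ a x y) {p p' : V → ℝ → ℝ} {t : ℝ}
    (h : ∀ y, p y t ≤ p' y t) (x : V) : gain N a p x t ≤ gain N a p' x t :=
  Finset.sum_le_sum fun y _ => mul_le_mul_of_nonneg_left (h y) (ha x y)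

lemma duhamel_mono (ha : ∀ x y, 0 ≤ a x y) {p p' : V → ℝ → ℝ} (hp : ∀ x, Continuous (p x))
    (hp' : ∀ x, Continuous (p' x)) {t : ℝ} (ht : 0 ≤ t)
    (h : ∀ y, ∀ s ∈ Icc 0 t, p y s ≤ p' y s) (x : V) :
    duhamel N a f p x t ≤ duhamel N a f p' x t := by
  unfold duhamel
  gcongr
  refine intervalIntegral.integral_mono_on ht
    ((continuous_exp_mul_gain hp x).intervalIntegrable _ _)
    ((continuous_exp_mul_gain hp' x).intervalIntegrable _ _) fun s hs => ?_
  exact mul_le_mul_of_nonneg_left (gain_mono ha (fun y => h y s hs) x) (Real.exp_pos _).le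

lemma duhamel_nonneg (ha : ∀ x y, 0 ≤ a x y) (hf : ∀ x, 0 ≤ f x) {p : V → ℝ → ℝ} {t : ℝ}
    (ht : 0 ≤ t) (h : ∀ y, ∀ s ∈ Icc 0 t, 0 ≤ p y s) (x : V) : 0 ≤ duhamel N a f p x t := by
  refine mul_nonneg (Real.exp_pos _).le (add_nonneg (hf x) ?_)
  exact intervalIntegral.integral_nonneg ht fun s hs => mul_nonneg (Real.exp_pos _).le
    (Finset.sum_nonneg fun y _ => mul_nonneg (ha x y) (h y s hs))

/-- Supersolutions decrease under the Duhamel operator: integrate `(e^{qs} φ)' ≥ e^{qs} ∑ a φ`. -/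
lemma duhamel_le_of_supersolution {φ φ' : V → ℝ → ℝ} {t : ℝ} (ht : 0 ≤ t)
    (hφ : ∀ x s, HasDerivAt (φ x) (φ' x s) s) (hφ' : ∀ x, Continuous (φ' x))
    (h : ∀ x, ∀ s ∈ Icc 0 t, gain N a φ x s ≤ φ' x s + exitRate N a x * φ x s)
    (h0 : ∀ x, f x ≤ φ x 0) (x : V) : duhamel N a f φ x t ≤ φ x t := by
  have hc : ∀ x, Continuous (φ x) := fun x =>
    continuous_iff_continuousAt.2 fun s => (hφ x s).continuousAt
  set q := exitRate N a x with hq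
  have hd : ∀ s, HasDerivAt (fun s => Real.exp (q * s) * φ x s)
      (Real.exp (q * s) * (φ' x s + q * φ x s)) s := by
    intro s
    have h1 : HasDerivAt (fun s => Real.exp (q * s)) (Real.exp (q * s) * q) s := by
      simpa using ((hasDerivAt_id s).const_mul q).exp
    exact (h1.mul (hφ x s)).congr_deriv (by ring)
  have hcd : Continuous fun s => Real.exp (q * s) * (φ' x s + q * φ x s) := by
    have := hc x
    have := hφ' x
    fun_prop
  have hle : ∫ s in (0 : ℝ)..t, Real.exp (q * s) * gain N a φ x s
      ≤ Real.exp (q * t) * φ x t - φ x 0 := by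
    calc _ ≤ ∫ s in (0 : ℝ)..t, Real.exp (q * s) * (φ' x s + q * φ x s) := by
          refine intervalIntegral.integral_mono_on ht
            ((continuous_exp_mul_gain hc x).intervalIntegrable _ _)
            (hcd.intervalIntegrable _ _) fun s hs => ?_
          exact mul_le_mul_of_nonneg_left (h x s hs) (Real.exp_pos _).le
      _ = _ := by
          rw [intervalIntegral.integral_eq_sub_of_hasDerivAt (fun s _ => hd s)
            (hcd.intervalIntegrable _ _)]
          simp
  have he : Real.exp (-(q * t)) * Real.exp (q * t) = 1 := by
    rw [← Real.exp_add]; simp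
  calc duhamel N a f φ x t
      ≤ Real.exp (-(q * t)) * (Real.exp (q * t) * φ x t) := by
        unfold duhamel
        gcongr
        linarith [h0 x]
    _ = φ x t := by rw [← mul_assoc, he, one_mul]

lemma approx_nonneg (ha : ∀ x y, 0 ≤ a x y) (hf : ∀ x, 0 ≤ f x) (n : ℕ) (x : V) {t : ℝ}
    (ht : 0 ≤ t) : 0 ≤ approx N a f n x t := by
  induction n generalizing x t with
  | zero => exact le_rfl
  | succ n ih =>
    rw [approx_succ]
    exact duhamel_nonneg ha hf ht (fun y s hs => ih y hs.1) x

lemma approx_le_succ (ha : ∀ x y, 0 ≤ a x y) (hf : ∀ x, 0 ≤ f x) (n : ℕ) (x : V) {t : ℝ}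
    (ht : 0 ≤ t) : approx N a f n x t ≤ approx N a f (n + 1) x t := by
  induction n generalizing x t with
  | zero => exact approx_nonneg ha hf 1 x ht
  | succ n ih =>
    rw [approx_succ n, approx_succ (n + 1)]
    exact duhamel_mono ha (continuous_approx n) (continuous_approx (n + 1)) ht
      (fun y s hs => ih y hs.1) x

/-- Comparison of the iterates with nonnegative supersolutions; no condition at infinity enters. -/
lemma approx_le_of_supersolution (ha : ∀ x y, 0 ≤ a x y) {φ φ' : V → ℝ → ℝ} {T : ℝ}
    (hφ : ∀ x s, HasDerivAt (φ x) (φ' x s) s) (hφ' : ∀ x, Continuous (φ' x))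
    (hφ0 : ∀ x, ∀ s ∈ Icc 0 T, 0 ≤ φ x s)
    (h : ∀ x, ∀ s ∈ Icc 0 T, gain N a φ x s ≤ φ' x s + exitRate N a x * φ x s)
    (h0 : ∀ x, f x ≤ φ x 0) (n : ℕ) (x : V) {t : ℝ} (ht : t ∈ Icc 0 T) :
    approx N a f n x t ≤ φ x t := by
  induction n generalizing x t with
  | zero => exact hφ0 x t ht
  | succ n ih =>
    have hsub : ∀ s ∈ Icc 0 t, s ∈ Icc 0 T := fun s hs => ⟨hs.1, hs.2.trans ht.2⟩
    have hc : ∀ x, Continuous (φ x) := fun x =>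
      continuous_iff_continuousAt.2 fun s => (hφ x s).continuousAt
    rw [approx_succ]
    exact (duhamel_mono ha (continuous_approx n) hc ht.1 (fun y s hs => ih y (hsub s hs)) x).trans
      (duhamel_le_of_supersolution ht.1 hφ hφ' (fun x s hs => h x s (hsub s hs)) h0 x)

lemma approx_le_const (ha : ∀ x y, 0 ≤ a x y) (hf : ∀ x, 0 ≤ f x) {M : ℝ} (hM : ∀ x, f x ≤ M)
    (n : ℕ) (x : V) {t : ℝ} (ht : 0 ≤ t) : approx N a f n x t ≤ M := by
  refine approx_le_of_supersolution (φ := fun _ _ => M) (φ' := fun _ _ => 0) (T := t) ha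
    (fun x s => hasDerivAt_const _ _) (fun _ => continuous_const)
    (fun _ _ _ => (hf x).trans (hM x)) (fun x s _ => ?_) hM n x ⟨ht, le_rfl⟩
  simp [gain, exitRate, Finset.sum_mul]

/-! ### The minimal solution -/

variable (N a f) in
/-- The limit of the Duhamel iterates, frozen at negative times, where the iteration is not
monotone. -/
noncomputable def limit (x : V) (t : ℝ) : ℝ := ⨆ n, approx N a f n x (max t 0)

lemma tendsto_approx (ha : ∀ x y, 0 ≤ a x y) (hf : ∀ x, 0 ≤ f x) {M : ℝ} (hM : ∀ x, f x ≤ M)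
    (x : V) (t : ℝ) :
    Tendsto (fun n => approx N a f n x (max t 0)) atTop (𝓝 (limit N a f x t)) := by
  refine tendsto_atTop_ciSup (monotone_nat_of_le_succ fun n =>
    approx_le_succ ha hf n x (le_max_right _ _)) ⟨M, ?_⟩
  rintro _ ⟨n, rfl⟩
  exact approx_le_const ha hf hM n x (le_max_right _ _)

lemma limit_mem_Icc (ha : ∀ x y, 0 ≤ a x y) (hf : ∀ x, 0 ≤ f x) {M : ℝ} (hM : ∀ x, f x ≤ M)
    (x : V) (t : ℝ) : limit N a f x t ∈ Icc 0 M :=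
  isClosed_Icc.mem_of_tendsto (tendsto_approx ha hf hM x t) <| Eventually.of_forall fun n =>
    ⟨approx_nonneg ha hf n x (le_max_right _ _), approx_le_const ha hf hM n x (le_max_right _ _)⟩

/-- The limit is a fixed point of the Duhamel operator, by dominated convergence. -/
lemma limit_eq_duhamel (ha : ∀ x y, 0 ≤ a x y) (hf : ∀ x, 0 ≤ f x) {M : ℝ} (hM : ∀ x, f x ≤ M)
    (x : V) {t : ℝ} (ht : 0 ≤ t) :
    limit N a f x t = duhamel N a f (limit N a f) x t := by
  have h1 : Tendsto (fun n => approx N a f (n + 1) x t) atTop (𝓝 (limit N a f x t)) := by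
    have := (tendsto_add_atTop_iff_nat 1).2 (tendsto_approx (N := N) ha hf hM x t)
    simpa only [max_eq_left ht] using this
  refine tendsto_nhds_unique h1 ?_
  simp only [approx_succ]
  unfold duhamel
  refine Tendsto.const_mul _ (Tendsto.const_add _ ?_)
  refine intervalIntegral.tendsto_integral_filter_of_dominated_convergence
    (fun s => Real.exp (exitRate N a x * s) * (∑ y ∈ N x, a x y * M))
    (Eventually.of_forall fun n =>
      (continuous_exp_mul_gain (continuous_approx n) x).aestronglyMeasurable)
    (Eventually.of_forall fun n => Eventually.of_forall fun s hs => ?_)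
    (Continuous.intervalIntegrable (by fun_prop) _ _)
    (Eventually.of_forall fun s hs => ?_)
  · rw [uIoc_of_le ht] at hs
    have hg : 0 ≤ gain N a (approx N a f n) x s := Finset.sum_nonneg fun y _ =>
      mul_nonneg (ha x y) (approx_nonneg ha hf n y hs.1.le)
    rw [Real.norm_of_nonneg (mul_nonneg (Real.exp_pos _).le hg)]
    refine mul_le_mul_of_nonneg_left (Finset.sum_le_sum fun y _ => ?_) (Real.exp_pos _).le
    exact mul_le_mul_of_nonneg_left (approx_le_const ha hf hM n y hs.1.le) (ha x y)
  · rw [uIoc_of_le ht] at hs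
    refine Tendsto.const_mul _ (tendsto_finsetSum _ fun y _ => Tendsto.const_mul _ ?_)
    simpa only [max_eq_left hs.1.le] using tendsto_approx (N := N) ha hf hM y s

lemma continuous_limit (ha : ∀ x y, 0 ≤ a x y) (hf : ∀ x, 0 ≤ f x) {M : ℝ} (hM : ∀ x, f x ≤ M)
    (x : V) : Continuous (limit N a f x) := by
  have hmeas : ∀ y, Measurable (limit N a f y) := fun y =>
    measurable_of_tendsto_metrizable (f := fun n t => approx N a f n y (max t 0))
      (fun n => ((continuous_approx n y).comp (continuous_id.max continuous_const)).measurable)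
      (tendsto_pi_nhds.2 fun t => tendsto_approx ha hf hM y t)
  have hint : ∀ u v : ℝ, IntervalIntegrable
      (fun s => Real.exp (exitRate N a x * s) * gain N a (limit N a f) x s)
      MeasureTheory.volume u v := by
    intro u v
    have hb : Continuous fun s : ℝ => Real.exp (exitRate N a x * s) * (∑ y ∈ N x, a x y * M) := by
      fun_prop
    refine (hb.intervalIntegrable u v).mono_fun' ?_ ?_
    · refine Measurable.aestronglyMeasurable ?_
      unfold gain
      fun_prop
    · refine Eventually.of_forall fun s => ?_
      have hg : 0 ≤ gain N a (limit N a f) x s := Finset.sum_nonneg fun y _ =>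
        mul_nonneg (ha x y) (limit_mem_Icc ha hf hM y s).1
      beta_reduce
      rw [Real.norm_of_nonneg (mul_nonneg (Real.exp_pos _).le hg)]
      refine mul_le_mul_of_nonneg_left (Finset.sum_le_sum fun y _ => ?_) (Real.exp_pos _).le
      exact mul_le_mul_of_nonneg_left (limit_mem_Icc ha hf hM y s).2 (ha x y)
  have hd : Continuous (duhamel N a f (limit N a f) x) := by
    have := intervalIntegral.continuous_primitive hint 0
    unfold duhamel
    fun_prop
  have heq : limit N a f x = fun t => duhamel N a f (limit N a f) x (max t 0) := by
    funext t
    rw [← limit_eq_duhamel ha hf hM x (le_max_right _ _)]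
    simp [limit]
  rw [heq]
  exact hd.comp (continuous_id.max continuous_const)

/-- The minimal solution with initial datum `f`. The outer Duhamel operator only changes negative
times and makes the function differentiable at `0` from both sides. -/
lemma exists_minimal_solution (ha : ∀ x y, 0 ≤ a x y) (hf : ∀ x, 0 ≤ f x) {M : ℝ}
    (hM : ∀ x, f x ≤ M) : ∃ v : V → ℝ → ℝ, (∀ x, ContDiff ℝ 1 (v x)) ∧ (∀ x, v x 0 = f x) ∧
      (∀ x t, 0 ≤ t → HasDerivAt (v x) (gain N a v x t - exitRate N a x * v x t) t) ∧
      ∀ x t, 0 ≤ t → Tendsto (fun n => approx N a f n x t) atTop (𝓝 (v x t)) := by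
  have hc := continuous_limit (N := N) ha hf hM
  have hd := hasDerivAt_duhamel (N := N) (a := a) (f := f) hc
  refine ⟨duhamel N a f (limit N a f), fun x => ?_, duhamel_initial _, fun x t ht => ?_,
    fun x t ht => ?_⟩
  · rw [contDiff_one_iff_deriv]
    refine ⟨fun t => (hd x t).differentiableAt, ?_⟩
    rw [funext fun t => (hd x t).deriv]
    have := continuous_gain (N := N) (a := a) hc x
    have := continuous_duhamel (N := N) (a := a) (f := f) hc x
    fun_prop
  · convert hd x t using 2
    unfold gain
    exact Finset.sum_congr rfl fun y _ => by rw [← limit_eq_duhamel ha hf hM y ht]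
  · rw [← limit_eq_duhamel ha hf hM x ht]
    simpa only [max_eq_left ht] using tendsto_approx (N := N) ha hf hM x t

end JumpProcess

namespace WeightedGraph

variable {V : Type*} {G : WeightedGraph V}

/-! ### The Laplacian as a finite sum -/

lemma laplacian_eq_sum (hfin : G.IsLocallyFinite) (g : V → ℝ) (x : V) :
    G.laplacian g x = (1 / G.μ x) * ∑ y ∈ (hfin x).toFinset, (g y - g x) * G.ω x y := by
  unfold laplacian
  congr 1
  refine tsum_eq_sum fun y hy => ?_
  have h : ¬ 0 < G.ω x y := by simpa using hy
  rw [le_antisymm (not_lt.1 h) (G.ω_nonneg x y), mul_zero]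

lemma laplacian_add (hfin : G.IsLocallyFinite) (g h : V → ℝ) (x : V) :
    G.laplacian (fun y => g y + h y) x = G.laplacian g x + G.laplacian h x := by
  simp only [laplacian_eq_sum hfin, ← mul_add, ← Finset.sum_add_distrib]
  congr 1
  exact Finset.sum_congr rfl fun y _ => by ring

lemma laplacian_const_mul (hfin : G.IsLocallyFinite) (k : ℝ) (g : V → ℝ) (x : V) :
    G.laplacian (fun y => k * g y) x = k * G.laplacian g x := by
  simp only [laplacian_eq_sum hfin, mul_left_comm k, Finset.mul_sum]
  exact Finset.sum_congr rfl fun y _ => by ring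

lemma isSolution_iff {ρ : V → ℝ} {u₀ : V → ℝ} {u : V → ℝ → ℝ} :
    G.IsSolution ρ (fun _ _ => 0) u₀ u ↔ (∀ x, ContDiffOn ℝ 1 (u x) (Ici 0)) ∧
      (∀ x t, 0 < t → G.parabolic ρ u x t = 0) ∧ ∀ x, u x 0 = u₀ x :=
  ⟨fun h => ⟨h.1.1, fun x t ht => le_antisymm (h.1.2 x t ht) (h.2.2 x t ht),
    fun x => le_antisymm (h.1.3 x) (h.2.3 x)⟩,
   fun h => ⟨⟨h.1, fun x t ht => (h.2.1 x t ht).le, fun x => (h.2.2 x).le⟩,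
    ⟨h.1, fun x t ht => (h.2.1 x t ht).ge, fun x => (h.2.2 x).ge⟩⟩⟩

lemma IsSolution.const (ρ : V → ℝ) (k : ℝ) :
    G.IsSolution ρ (fun _ _ => 0) (fun _ => k) (fun _ _ => k) :=
  isSolution_iff.2 ⟨fun _ => contDiffOn_const, fun x t _ => by simp [parabolic, laplacian],
    fun _ => rfl⟩

/-- Linearity of the homogeneous Cauchy problem. -/
lemma IsSolution.add_const_mul (hfin : G.IsLocallyFinite) {ρ u₀ w₀ : V → ℝ} {u w : V → ℝ → ℝ}
    (hu : G.IsSolution ρ (fun _ _ => 0) u₀ u) (hw : G.IsSolution ρ (fun _ _ => 0) w₀ w) (k : ℝ) :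
    G.IsSolution ρ (fun _ _ => 0) (fun x => u₀ x + k * w₀ x) (fun x t => u x t + k * w x t) := by
  obtain ⟨hu1, hu2, hu3⟩ := isSolution_iff.1 hu
  obtain ⟨hw1, hw2, hw3⟩ := isSolution_iff.1 hw
  refine isSolution_iff.2 ⟨fun x => (hu1 x).add (contDiffOn_const.mul (hw1 x)),
    fun x t ht => ?_, fun x => by simp only [hu3, hw3]⟩
  have hdu : DifferentiableAt ℝ (u x) t :=
    ((hu1 x).differentiableOn one_ne_zero).differentiableAt (Ici_mem_nhds ht)
  have hdw : DifferentiableAt ℝ (w x) t :=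
    ((hw1 x).differentiableOn one_ne_zero).differentiableAt (Ici_mem_nhds ht)
  have hd := (hdu.hasDerivAt.add (hdw.hasDerivAt.const_mul k)).deriv
  have h1 := hu2 x t ht
  have h2 := hw2 x t ht
  unfold parabolic at h1 h2 ⊢
  rw [laplacian_add hfin, laplacian_const_mul hfin]
  change ρ x * deriv (fun t => u x t + k * w x t) t - _ = 0
  have hd' : deriv (fun t => u x t + k * w x t) t = deriv (u x) t + k * deriv (w x) t := hd
  rw [hd']
  linear_combination h1 + k * h2

lemma IsBoundedSpaceTime.const (k : ℝ) : IsBoundedSpaceTime (fun (_ : V) _ => k) :=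
  ⟨|k|, fun _ _ _ => le_rfl⟩

lemma IsBoundedSpaceTime.add_const_mul {u w : V → ℝ → ℝ} (hu : IsBoundedSpaceTime u)
    (hw : IsBoundedSpaceTime w) (k : ℝ) : IsBoundedSpaceTime (fun x t => u x t + k * w x t) := by
  obtain ⟨A, hA⟩ := hu
  obtain ⟨B, hB⟩ := hw
  refine ⟨A + |k| * B, fun x t ht => (abs_add_le _ _).trans (add_le_add (hA x t ht) ?_)⟩
  rw [abs_mul]
  exact mul_le_mul_of_nonneg_left (hB x t ht) (abs_nonneg k)

/-! ### Decay of the minimal solution -/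

/-- The minimal solution of a nonnegative bounded datum, and its decay when there is a nonnegative
`h` with `Δ h ≤ -ρ`: the function `M (1 - t / T + h / T)` is a supersolution which is nonnegative up
to time `T`, where it equals `M h / T`. -/
lemma exists_isSolution_le_barrier (hfin : G.IsLocallyFinite) {ρ : V → ℝ} (hρ : ∀ x, 0 < ρ x)
    {h : V → ℝ} (hh : ∀ x, 0 ≤ h x) (hΔ : ∀ x, G.laplacian h x ≤ -ρ x)
    {f : V → ℝ} (hf : ∀ x, 0 ≤ f x) {M : ℝ} (hM0 : 0 ≤ M) (hM : ∀ x, f x ≤ M) :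
    ∃ v : V → ℝ → ℝ, G.IsSolution ρ (fun _ _ => 0) f v ∧
      (∀ x t, 0 ≤ t → v x t ∈ Icc 0 M) ∧ ∀ x t, 0 < t → v x t ≤ M * (h x / t) := by
  set N : V → Finset V := fun x => (hfin x).toFinset
  set a : V → V → ℝ := fun x y => G.ω x y / (G.μ x * ρ x) with ha_def
  have ha : ∀ x y, 0 ≤ a x y := fun x y =>
    div_nonneg (G.ω_nonneg x y) (mul_pos (G.μ_pos x) (hρ x)).le
  -- the generator of the jump process with rates `a` is `ρ⁻¹ Δ`
  have hgen : ∀ (p : V → ℝ → ℝ) (x : V) (t : ℝ),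
      ρ x * (JumpProcess.gain N a p x t - JumpProcess.exitRate N a x * p x t) =
        G.laplacian (fun y => p y t) x := by
    intro p x t
    have := (hρ x).ne'
    have := (G.μ_pos x).ne'
    rw [laplacian_eq_sum hfin, JumpProcess.gain, JumpProcess.exitRate, Finset.sum_mul,
      ← Finset.sum_sub_distrib, Finset.mul_sum, Finset.mul_sum]
    refine Finset.sum_congr rfl fun y _ => ?_
    simp only [ha_def]
    field_simp
  obtain ⟨v, hv1, hv0, hvd, hvlim⟩ := JumpProcess.exists_minimal_solution (N := N) ha hf hM
  refine ⟨v, isSolution_iff.2 ⟨fun x => (hv1 x).contDiffOn, fun x t ht => ?_, hv0⟩,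
    fun x t ht => ?_, fun x t ht => ?_⟩
  · rw [parabolic, (hvd x t ht.le).deriv, hgen, sub_self]
  · exact isClosed_Icc.mem_of_tendsto (hvlim x t ht) <| Eventually.of_forall fun n =>
      ⟨JumpProcess.approx_nonneg ha hf n x ht, JumpProcess.approx_le_const ha hf hM n x ht⟩
  · refine le_of_tendsto' (hvlim x t ht.le) fun n => ?_
    have hbound := JumpProcess.approx_le_of_supersolution (N := N) (f := f) (T := t) ha
      (φ := fun x s => M * (1 - s / t + h x / t)) (φ' := fun _ _ => M * (-(1 / t)))
      (fun x s => ?_) (fun _ => continuous_const) (fun x s hs => ?_) (fun x s hs => ?_)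
      (fun x => ?_) n x (t := t) ⟨ht.le, le_rfl⟩
    · simpa [div_self ht.ne'] using hbound
    · exact ((((hasDerivAt_id s).div_const t).const_sub 1).add_const _).const_mul M
    · have : s / t ≤ 1 := (div_le_one ht).2 hs.2
      have : 0 ≤ h x / t := div_nonneg (hh x) ht.le
      exact mul_nonneg hM0 (by linarith)
    · have h1 := hgen (fun x s => M * (1 - s / t + h x / t)) x s
      have h2 : G.laplacian (fun y => M * (1 - s / t + h y / t)) x =
          M / t * G.laplacian h x := by
        rw [← laplacian_const_mul hfin]
        simp only [laplacian_eq_sum hfin]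
        congr 1
        exact Finset.sum_congr rfl fun y _ => by ring
      rw [h2] at h1
      have h3 : M / t * G.laplacian h x ≤ ρ x * (M * (-(1 / t))) := by
        have := mul_le_mul_of_nonneg_left (hΔ x) (div_nonneg hM0 ht.le)
        calc _ ≤ _ := this
          _ = _ := by ring
      rw [← h1] at h3
      linarith [le_of_mul_le_mul_left h3 (hρ x)]
    · have : 0 ≤ h x / t := div_nonneg (hh x) ht.le
      simp only [zero_div, sub_zero]
      nlinarith [hM x, mul_nonneg hM0 this]

/-! ### Balls -/

lemma finite_setOf_walk_length_le (hfin : G.IsLocallyFinite) (n : ℕ) (x : V) :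
    {y | ∃ p : G.toSimpleGraph.Walk x y, p.length ≤ n}.Finite := by
  induction n generalizing x with
  | zero =>
    refine (finite_singleton x).subset ?_
    rintro y ⟨p, hp⟩
    exact (SimpleGraph.Walk.eq_of_length_eq_zero (Nat.le_zero.1 hp)).symm
  | succ n ih =>
    refine ((finite_singleton x).union ((hfin x).biUnion fun z _ => ih z)).subset ?_
    rintro y ⟨p, hp⟩
    cases p with
    | nil => exact Or.inl rfl
    | cons hadj q =>
      refine Or.inr (mem_biUnion hadj ⟨q, ?_⟩)
      simpa using hp

lemma finite_ball (hconn : G.IsConnected) (hfin : G.IsLocallyFinite) (o : V) (n : ℕ) :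
    {x | G.dist o x ≤ n}.Finite := by
  refine (finite_setOf_walk_length_le hfin n o).subset fun x hx => ?_
  obtain ⟨p, hp⟩ := SimpleGraph.Connected.exists_walk_length_eq_dist hconn o x
  exact ⟨p, hp.le.trans hx⟩

lemma tendsto_dist_cofinite (hconn : G.IsConnected) (hfin : G.IsLocallyFinite) (o : V) :
    Tendsto (G.dist o) cofinite atTop := by
  refine tendsto_atTop.2 fun n => ?_
  exact (finite_ball hconn hfin o n).subset fun x (hx : ¬ n ≤ G.dist o x) => (not_le.1 hx).le

/-- A function which is constant outside a ball is bounded above. -/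
lemma exists_le_of_eq_const_outside_ball (hconn : G.IsConnected) (hfin : G.IsLocallyFinite) (o : V)
    {γ R : ℝ} {u₀ : V → ℝ} (hu₀ : ∀ x, R ≤ (G.dist o x : ℝ) → u₀ x = γ) :
    ∃ M, ∀ x, u₀ x ≤ M := by
  have hB : {x | (G.dist o x : ℝ) < R}.Finite :=
    (finite_ball hconn hfin o ⌈R⌉₊).subset fun x hx => by
      exact_mod_cast (le_of_lt hx).trans (Nat.le_ceil R)
  obtain ⟨M, hM⟩ := (hB.image u₀).bddAbove
  refine ⟨max M γ, fun x => ?_⟩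
  rcases lt_or_ge (G.dist o x : ℝ) R with hx | hx
  · exact le_max_of_le_left (hM (mem_image_of_mem _ hx))
  · exact (hu₀ x hx).le.trans (le_max_right _ _)

/-! ### A radial superharmonic function on the tree -/

/-- The Laplacian of a radial function off the root. -/
lemma IsSphericallySymmetricTree.laplacian_radial {o : V} {b : ℕ → ℕ}
    (htree : G.IsSphericallySymmetricTree o b) (H : ℕ → ℝ)
    {x : V} {r : ℕ} (hr : G.dist o x = r + 1) :
    G.laplacian (fun y => H (G.dist o y)) x =
      b (r + 1) * (H (r + 2) - H (r + 1)) + (H r - H (r + 1)) := by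
  set S : Set V := {y | G.dist o y = r + 1 + 1}
  set S' : Set V := {y | G.dist o y + 1 = r + 1}
  have hout : ∑' y, S.indicator (G.ω x) y = b (r + 1) := by
    have := htree.outer x (by omega)
    rw [outerDegree, htree.measure, div_one, one_mul, hr] at this
    rw [← tsum_subtype, ← this]
    rfl
  have hinn : ∑' y, S'.indicator (G.ω x) y = 1 := by
    have := htree.inner x (by omega)
    rw [innerDegree, htree.measure, div_one, one_mul, hr] at this
    rw [← tsum_subtype, ← this]
    rfl
  have hterm : ∀ y, (H (G.dist o y) - H (G.dist o x)) * G.ω x y =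
      (H (r + 2) - H (r + 1)) * S.indicator (G.ω x) y +
        (H r - H (r + 1)) * S'.indicator (G.ω x) y := by
    intro y
    rw [hr]
    by_cases h1 : G.dist o y = r + 2
    · have hS : y ∈ S := by simp only [S, mem_ofPred_eq]; omega
      have hS' : y ∉ S' := by simp only [S', mem_ofPred_eq]; omega
      rw [indicator_of_mem hS, indicator_of_notMem hS', h1]; ring
    by_cases h2 : G.dist o y = r
    · have hS : y ∉ S := by simp only [S, mem_ofPred_eq]; omega
      have hS' : y ∈ S' := by simp only [S', mem_ofPred_eq]; omega
      rw [indicator_of_notMem hS, indicator_of_mem hS', h2]; ring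
    have hS : y ∉ S := by simp only [S, mem_ofPred_eq]; omega
    have hS' : y ∉ S' := by simp only [S', mem_ofPred_eq]; omega
    rw [indicator_of_notMem hS, indicator_of_notMem hS']
    have hω : G.ω x y = 0 := by
      by_contra hne
      have hadj : G.toSimpleGraph.Adj x y := lt_of_le_of_ne (G.ω_nonneg x y) (Ne.symm hne)
      have hd := hadj.diff_dist_adj (u := o)
      have hs : G.dist o x ≠ G.dist o y := fun he => hne (htree.sphere x y he)
      simp only [WeightedGraph.dist] at hr h1 h2 hs
      omega
    rw [hω]; ring
  rw [laplacian, htree.measure, div_one, one_mul, tsum_congr hterm,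
    ((((G.ω_summable x).indicator S).mul_left _).tsum_add
      (((G.ω_summable x).indicator S').mul_left _)), tsum_mul_left, tsum_mul_left, hout, hinn]
  ring

/-- The root has a neighbour, and all its neighbours lie on the unit sphere. -/
lemma IsSphericallySymmetricTree.laplacian_radial_root_le [Nontrivial V] (hconn : G.IsConnected)
    {o : V} {b : ℕ → ℕ} (htree : G.IsSphericallySymmetricTree o b)
    {H : ℕ → ℝ} (hH : H 1 ≤ H 0) :
    G.laplacian (fun y => H (G.dist o y)) o ≤ H 1 - H 0 := by
  have ho : G.dist o o = 0 := SimpleGraph.dist_self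
  have hterm : ∀ y, (H (G.dist o y) - H (G.dist o o)) * G.ω o y = (H 1 - H 0) * G.ω o y := by
    intro y
    rcases (G.ω_nonneg o y).eq_or_lt with h | h
    · simp [← h]
    · have : G.dist o y = 1 := SimpleGraph.dist_eq_one_iff_adj.2 h
      rw [this, ho]
  obtain ⟨y, hy⟩ : ∃ y, G.toSimpleGraph.Adj o y :=
    SimpleGraph.Preconnected.exists_adj_of_nontrivial hconn.preconnected o
  have hone : G.ω o y = 1 := (htree.weight o y).resolve_left (ne_of_gt hy)
  have hdeg : 1 ≤ ∑' y, G.ω o y :=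
    hone ▸ (G.ω_summable o).le_tsum y fun z _ => G.ω_nonneg o z
  rw [laplacian, htree.measure, div_one, one_mul, tsum_congr hterm, tsum_mul_left]
  nlinarith

end WeightedGraph

/-- The sequence with `a₀ = c₀` and `b aₙ₊₁ = aₙ + cₙ₊₁`. -/
noncomputable def radialDecrement (b : ℝ) (c : ℕ → ℝ) : ℕ → ℝ
  | 0 => c 0
  | n + 1 => (radialDecrement b c n + c (n + 1)) / b

lemma radialDecrement_nonneg {b : ℝ} (hb : 0 ≤ b) {c : ℕ → ℝ} (hc : ∀ n, 0 ≤ c n) (n : ℕ) :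
    0 ≤ radialDecrement b c n := by
  induction n with
  | zero => exact hc 0
  | succ n ih => exact div_nonneg (add_nonneg ih (hc _)) hb

/-- Division by `b ≥ 2` makes the recursion a contraction on partial sums. -/
lemma summable_radialDecrement {b : ℝ} (hb : 2 ≤ b) {c : ℕ → ℝ} (hc : ∀ n, 0 ≤ c n)
    (hs : Summable c) : Summable (radialDecrement b c) := by
  have ha := radialDecrement_nonneg (zero_le_two.trans hb) hc
  set C := ∑' n, c n
  have hC : 0 ≤ C := tsum_nonneg hc
  refine summable_of_sum_range_le (c := 2 * c 0 + C) ha fun n => ?_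
  induction n with
  | zero => simpa using by linarith [hc 0]
  | succ n ih =>
    have hstep : ∀ i, radialDecrement b c (i + 1) ≤ (radialDecrement b c i + c (i + 1)) / 2 :=
      fun i => div_le_div_of_nonneg_left (add_nonneg (ha i) (hc _)) two_pos hb
    have hc' : ∑ i ∈ Finset.range n, c (i + 1) ≤ C := by
      have h1 := hs.sum_le_tsum (Finset.range (n + 1)) fun i _ => hc i
      rw [Finset.sum_range_succ'] at h1
      linarith [hc 0]
    have hsum := Finset.sum_le_sum fun i (_ : i ∈ Finset.range n) => hstep i
    rw [← Finset.sum_div, Finset.sum_add_distrib] at hsum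
    rw [Finset.sum_range_succ']
    have h0 : radialDecrement b c 0 = c 0 := rfl
    rw [h0]
    linarith

namespace WeightedGraph

variable {V : Type*} {G : WeightedGraph V}

/-- A radial function `h → 0` with `Δ h ≤ -ρ`: its decrements `a r = h r - h (r + 1)` have to satisfy
`b a r ≥ a (r - 1) + c r` where `c r ≥ ρ` on the sphere of radius `r`, and this recursion has a
summable solution. -/
lemma IsSphericallySymmetricTree.exists_radial_barrier [Nontrivial V] (hconn : G.IsConnected)
    {o : V} {b₀ : ℕ} (hb₀ : 2 ≤ b₀) (htree : G.IsSphericallySymmetricTree o (fun _ => b₀))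
    {ρ : V → ℝ} {c : ℕ → ℝ} (hc : ∀ n, 0 ≤ c n) (hs : Summable c)
    (hρ : ∀ x, ρ x ≤ c (G.dist o x)) :
    ∃ H : ℕ → ℝ, (∀ n, 0 ≤ H n) ∧ Tendsto H atTop (𝓝 0) ∧
      ∀ x, G.laplacian (fun y => H (G.dist o y)) x ≤ -ρ x := by
  have hb : (2 : ℝ) ≤ b₀ := by exact_mod_cast hb₀
  set a := radialDecrement b₀ c with ha_def
  have ha : ∀ n, 0 ≤ a n := radialDecrement_nonneg (zero_le_two.trans hb) hc
  have hsum : Summable a := summable_radialDecrement hb hc hs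
  set H : ℕ → ℝ := fun n => ∑' k, a (k + n) with hH_def
  have hH : ∀ n, H n = a n + H (n + 1) := by
    intro n
    have h := ((summable_nat_add_iff n).2 hsum).tsum_eq_zero_add
    simp only [hH_def]
    rw [h, zero_add]
    congr 1
    exact tsum_congr fun k => by congr 1; ring
  refine ⟨H, fun n => tsum_nonneg fun k => ha _, tendsto_sum_nat_add a, fun x => ?_⟩
  have hx := hρ x
  rcases hr : G.dist o x with _ | r
  · obtain rfl : o = x := (SimpleGraph.Connected.dist_eq_zero_iff hconn).1 hr
    have h0 : a 0 = c 0 := rfl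
    have h1 := hH 0
    have h2 := htree.laplacian_radial_root_le hconn (H := H) (by linarith [ha 0])
    rw [hr] at hx
    linarith
  · have h1 : b₀ * a (r + 1) = a r + c (r + 1) := mul_div_cancel₀ _ (by positivity)
    rw [htree.laplacian_radial H hr]
    rw [hr] at hx
    have h2 := hH r
    have h3 : H (r + 2) - H (r + 1) = -a (r + 1) := by linarith [hH (r + 1)]
    rw [h3]
    linarith

end WeightedGraph

/-! ### Existence and nonuniqueness -/

open WeightedGraph in
theorem corollary3p11 {V : Type*} [Countable V] [Infinite V] (G : WeightedGraph V)
    (hconn : G.IsConnected) (hfin : G.IsLocallyFinite) (o : V) (b₀ : ℕ) (hb₀ : 2 ≤ b₀)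
    (htree : G.IsSphericallySymmetricTree o (fun _ => b₀))
    (ρ : V → ℝ) (hρ : ∀ x, 0 < ρ x) (c₀ α : ℝ) (hc₀ : 0 < c₀) (hα : 1 < α)
    (hdecay : ∀ x, ρ x ≤ c₀ * (1 + (G.dist o x : ℝ)) ^ (-α))
    (γ R : ℝ) (u₀ : V → ℝ) (hu₀ : ∀ x, γ ≤ u₀ x)
    (hu₀' : ∀ x, R ≤ (G.dist o x : ℝ) → u₀ x = γ) :
    (∃ u : V → ℝ → ℝ, G.IsSolution ρ (fun _ _ => 0) u₀ u ∧
        WeightedGraph.IsBoundedSpaceTime u ∧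
        ∀ t₀ : ℝ, 0 < t₀ → Tendsto (fun x => u x t₀) (comap (G.dist o) atTop) (𝓝 γ)) ∧
    (∃ u : ℕ → V → ℝ → ℝ,
        (∀ i, G.IsSolution ρ (fun _ _ => 0) u₀ (u i) ∧
          WeightedGraph.IsBoundedSpaceTime (u i)) ∧
        ∀ i j, i ≠ j → ∀ T : ℝ, 0 < T → ∃ x, ∃ t ∈ Ioc 0 T, u i x t ≠ u j x t) := by
  have hs : Summable fun n : ℕ => c₀ * (1 + (n : ℝ)) ^ (-α) := by
    have h := (summable_nat_add_iff 1).2 (Real.summable_nat_rpow.2 (neg_lt_neg hα))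
    refine (h.congr fun n => ?_).mul_left c₀
    rw [Nat.cast_add_one, add_comm]
  obtain ⟨H, hH0, hHlim, hΔ⟩ :=
    htree.exists_radial_barrier hconn hb₀ (fun n => by positivity) hs hdecay
  obtain ⟨M, hM⟩ := exists_le_of_eq_const_outside_ball hconn hfin o hu₀'
  obtain ⟨v, hv, hvM, hvdecay⟩ := exists_isSolution_le_barrier hfin hρ (fun _ => hH0 _) hΔ
    (f := fun x => u₀ x - γ) (fun x => sub_nonneg.2 (hu₀ x)) (M := M - γ)
    (by linarith [hu₀ o, hM o]) (fun x => by linarith [hM x])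
  obtain ⟨p, hp, hp1, hpdecay⟩ := exists_isSolution_le_barrier hfin hρ (fun _ => hH0 _) hΔ
    (f := fun _ => 1) (fun _ => zero_le_one) zero_le_one (fun _ => le_rfl)
  -- the two solutions `u = γ + v` with datum `u₀` and `w = 1 - p` with datum `0`
  have hu : G.IsSolution ρ (fun _ _ => 0) u₀ (fun x t => γ + 1 * v x t) := by
    simpa using IsSolution.add_const_mul hfin (IsSolution.const ρ γ) hv 1
  have hub : IsBoundedSpaceTime (fun x t => γ + 1 * v x t) :=
    (IsBoundedSpaceTime.const γ).add_const_mul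
      ⟨M - γ, fun x t ht => abs_le.2 ⟨by linarith [(hvM x t ht).1, (hvM x t ht).2],
        (hvM x t ht).2⟩⟩ 1
  have hw : G.IsSolution ρ (fun _ _ => 0) (fun _ => 0) (fun x t => 1 + -1 * p x t) := by
    simpa using IsSolution.add_const_mul hfin (IsSolution.const ρ 1) hp (-1)
  have hwb : IsBoundedSpaceTime (fun x t => 1 + -1 * p x t) :=
    (IsBoundedSpaceTime.const 1).add_const_mul
      ⟨1, fun x t ht => abs_le.2 ⟨by linarith [(hp1 x t ht).1], (hp1 x t ht).2⟩⟩ (-1)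
  refine ⟨⟨_, hu, hub, fun t ht => ?_⟩,
    fun i x t => (γ + 1 * v x t) + i * (1 + -1 * p x t), fun i => ⟨?_, hub.add_const_mul hwb i⟩,
    fun i j hij T hT => ?_⟩
  · have hup : Tendsto (fun x => γ + (M - γ) * (H (G.dist o x) / t))
        (comap (G.dist o) atTop) (𝓝 γ) := by
      have hH : Tendsto (fun x => H (G.dist o x)) (comap (G.dist o) atTop) (𝓝 0) :=
        hHlim.comp tendsto_comap
      simpa using ((hH.div_const t).const_mul (M - γ)).const_add γ
    refine tendsto_of_tendsto_of_tendsto_of_le_of_le tendsto_const_nhds hup (fun x => ?_)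
      fun x => ?_
    · have := (hvM x t ht.le).1
      dsimp only
      linarith
    · have := hvdecay x t ht
      dsimp only
      linarith
  · simpa using hu.add_const_mul hfin hw i
  · -- far from the root `H < T`, so that `p < 1` at time `T`
    have hev : ∀ᶠ x in cofinite, H (G.dist o x) < T :=
      (hHlim.comp (tendsto_dist_cofinite hconn hfin o)).eventually_lt_const hT
    obtain ⟨x, hx⟩ := hev.exists
    refine ⟨x, T, ⟨hT, le_rfl⟩, fun heq => hij ?_⟩
    have hlt : p x T < 1 :=
      (hpdecay x T hT).trans_lt (by rw [one_mul]; exact (div_lt_one hT).2 hx)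
    have hne : 1 + -1 * p x T ≠ 0 := by linarith
    exact_mod_cast mul_right_cancel₀ hne (add_left_cancel heq)
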